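/- **Setting.** Let $n\ge 1$ and consider the Cauchy problem $$u_t+|\nabla u|\,f\big(u,\mu(\{u(\cdot,t)<u(x,t)\})\big)=0\ \text{ in }\mathbb R^n\times(0,\infty),\qquad u(\cdot,0)=u_0\ \text{ in }\mathbb R^n .$$ Assume the following. - $f:\mathbb R\times[0,\infty)\to\mathbb R$ is bounded and continuous, and $|f(r,q_1)-f(r,q_2)|\le\omega_f(|q_1-q_2|)$ for all $r\in\mathbb R$, $q_1,q_2\ge0$ and some modulus $\omega_f$. A modulus is a continuous, strictly increasing function on $[0,\infty)$ that vanishes at $0$. - $f(r_1,q)\le f(r_2,q)$ for $r_1<r_2$, $q\ge 0$, and $f(r,q_1)<f(r,q_2)$ for $r\in\mathbb R$, $0\le q_1<q_2$. - $\mu(A)=\int_A\Theta(x)\,dx$, where $\Theta\in L^1(\mathbb R^n)$ and $\Theta>0$ in $\mathbb R^n$. - $u_0:\mathbb R^n\to\mathbb R$ is uniformly continuous, and $\lim_{R\to\infty}\inf\{u_0(y):|y|\ge R\}>u_0(x)$ for every $x\in\mathbb R^n$. For a set $A\subset\mathbb R^n$ let $\mathrm{sd}(x,A)=\mathrm{dist}(x,A)-\mathrm{dist}(x,\mathbb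 R^n\setminus A)$, with $\mathrm{dist}(x,\emptyset)=+\infty$. For $h,s\in\mathbb R$ put $$D_h(0)=\{u_0<h\},\quad E_h(0)=\{u_0\le h\},\quad D_h(s)=\{x:\mathrm{sd}(x,D_h(0))<s\},\quad E_h(s)=\{x:\mathrm{sd}(x,E_h(0))\le s\}$$ (the two definitions agree for $s=0$). A viscosity subsolution is a locally bounded upper semicontinuous function $u$ on $\mathbb R^n\times(0,\infty)$ such that $$\varphi_t+|\nabla\varphi|\,f\big(u,\mu(\{u(\cdot,t_0)<u(x_0,t_0)\})\big)\le0\quad\text{at }(x_0,t_0)$$ whenever $\varphi\in C^1(\mathbb R^n\times(0,\infty))$ and $u-\varphi$ has a local maximum at $(x_0,t_0)$. A viscosity supersolution is a locally bounded lower semicontinuous function $u$ on $\mathbb R^n\times(0,\infty)$ such that $$\varphi_t+|\nabla\varphi|\,f\big(u,\mu(\{u(\cdot,t_0)\le u(x_0,t_0)\})\big)\ge0\quad\text{at }(x_0,t_0)$$ whenever $\varphi\in C^1(\mathbb R^n\times(0,\infty))$ and $u-\varphi$ has a local minimum at $(x_0,t_0)$. A solution is a function that is both. **Theorem.** Let $\overline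 h\in\mathbb R$ satisfy $$f(\overline h,\mu(D_{\overline h}(0)))\le0\le f(\overline h,\mu(E_{\overline h}(0))).$$ Let $u\in C(\mathbb R^n\times[0,\infty))$ be a viscosity solution of the Cauchy problem such that for every $T>0$ there is $M_T>0$ with $|u(x,t)|\le M_T(|x|+1)$ on $\mathbb R^n\times[0,T]$. Assume in addition that $$\limsup_{s\to0+}\frac{f(\overline h,\mu(D_{\overline h}(-s)))}{s}<0$$ (the upper limit may be $-\infty$), and that for every sufficiently small $b>0$ there exists $a>0$ such that $$f(h,\mu(E_h(s)))-f(h,\mu(E_h(0)))\ge a\,s\qquad\text{for all }\overline h\le h\le\overline h+b,\ 0\le s\le 1/b.$$ Then for every compact set $K\subset\mathbb R^n$ there exist $C_K>0$ and $\lambda>0$ with the following two properties. 1. For every modulus of continuity $g$ of $u_0$, that is, for every continuous, strictly increasing $g:[0,\infty)\to[0,\infty)$ with $g(0)=0$ and $|u_0(x)-u_0(y)|\le g(|x-y|)$ for all $x,y\in\mathbb R^n$, $$|u(x,t)-\overline h|\le g\big(C_Ke^{-\lambda t}\big)\qquad\text{for all }x\in K\text{ and all sufficiently large }t .$$ 2.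 If $u_0$ is Hölder continuous with exponent $\alpha\in(0,1]$, then there exists $C_K'>0$ such that $$|u(x,t)-\overline h|\le C_K'\,e^{-\alpha\lambda t}\qquad\text{for all }x\in K\text{ and all sufficiently large }t .$$ -/

import Mathlib

open MeasureTheory Filter Topology Set
open scoped NNReal ENNReal

noncomputable section

namespace NonlocalHJ

/-- The Euclidean space `ℝⁿ`. -/
abbrev Space (n : ℕ) : Type := EuclideanSpace ℝ (Fin n)

/-- A function `[0, ∞) → [0, ∞)` that is continuous, strictly increasing and vanishes at `0`.
Only the values of `g` on `[0, ∞)` matter. -/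
structure IsModulus (g : ℝ → ℝ) : Prop where
  continuousOn : ContinuousOn g (Ici 0)
  strictMonoOn : StrictMonoOn g (Ici 0)
  zero : g 0 = 0

/-- `g` is a modulus of continuity of `v : ℝⁿ → ℝ`. -/
structure IsModulusOfContinuity {n : ℕ} (v : Space n → ℝ) (g : ℝ → ℝ) : Prop where
  isModulus : IsModulus g
  le : ∀ x y, |v x - v y| ≤ g (dist x y)

/-- The regularity assumption on `f : ℝ × [0, ∞) → ℝ`: it is bounded and continuous, and it is
continuous in the second variable with a modulus that does not depend on the first one. -/
structure RegularNonlinearity (f : ℝ → ℝ≥0 → ℝ) : Prop where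
  bounded : ∃ M : ℝ, ∀ r q, |f r q| ≤ M
  continuous : Continuous fun p : ℝ × ℝ≥0 => f p.1 p.2
  modulus : ∃ ω : ℝ → ℝ, IsModulus ω ∧ ∀ r q₁ q₂, |f r q₁ - f r q₂| ≤ ω |(q₁ : ℝ) - q₂|

/-- `f` is nondecreasing in the first and strictly increasing in the second variable. -/
structure MonotoneNonlinearity (f : ℝ → ℝ≥0 → ℝ) : Prop where
  mono_left : ∀ r₁ r₂ q, r₁ < r₂ → f r₁ q ≤ f r₂ q
  strictMono_right : ∀ r q₁ q₂, q₁ < q₂ → f r q₁ < f r q₂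

/-- `Θ` is an integrable and everywhere positive density. -/
structure PositiveDensity {n : ℕ} (Θ : Space n → ℝ) : Prop where
  integrable : Integrable Θ volume
  pos : ∀ x, 0 < Θ x

/-- `u₀` is uniformly continuous and coercive: `lim_{R → ∞} inf {u₀ y : |y| ≥ R} > u₀ x` for
every `x`. The infimum is nondecreasing in `R`, and its limit may be `+∞`; the limit exceeds
`u₀ x` exactly when some infimum is bounded below by a number `c > u₀ x`. -/
structure CoerciveInitialDatum {n : ℕ} (u₀ : Space n → ℝ) : Prop where
  uniformContinuous : UniformContinuous u₀
  coercive : ∀ x, ∃ c > u₀ x, ∃ R : ℝ, ∀ y, R ≤ ‖y‖ → c ≤ u₀ y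

/-- `μ(A) = ∫_A Θ(x) dx`, as a number in `[0, ∞)`; the integral is finite for integrable `Θ`. -/
def mass {n : ℕ} (Θ : Space n → ℝ) (A : Set (Space n)) : ℝ≥0 :=
  ((volume.withDensity fun x => ENNReal.ofReal (Θ x)) A).toNNReal

/-- The signed distance `sd(x, A) = dist(x, A) - dist(x, ℝⁿ ∖ A)`, with values in the extended
reals: the distance to the empty set is `+∞`. -/
def signedDistSet {n : ℕ} (x : Space n) (A : Set (Space n)) : EReal :=
  (Metric.infEDist x A : EReal) - (Metric.infEDist x Aᶜ : EReal)

/-- `D_h(0) = {u₀ < h}`. -/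
def sublevelD {n : ℕ} (u₀ : Space n → ℝ) (h : ℝ) : Set (Space n) := {x | u₀ x < h}

/-- `E_h(0) = {u₀ ≤ h}`. -/
def sublevelE {n : ℕ} (u₀ : Space n → ℝ) (h : ℝ) : Set (Space n) := {x | u₀ x ≤ h}

/-- `D_h(s) = {x : sd(x, D_h(0)) < s}`. -/
def parallelD {n : ℕ} (u₀ : Space n → ℝ) (h s : ℝ) : Set (Space n) :=
  {x | signedDistSet x (sublevelD u₀ h) < (s : EReal)}

/-- `E_h(s) = {x : sd(x, E_h(0)) ≤ s}`. -/
def parallelE {n : ℕ} (u₀ : Space n → ℝ) (h s : ℝ) : Set (Space n) :=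
  {x | signedDistSet x (sublevelE u₀ h) ≤ (s : EReal)}

/-- The domain `ℝⁿ × (0, ∞)`. -/
def openDomain (n : ℕ) : Set (Space n × ℝ) := univ ×ˢ Ioi 0

/-- `u` is locally bounded in `ℝⁿ × (0, ∞)`. -/
def LocallyBounded {n : ℕ} (u : Space n → ℝ → ℝ) : Prop :=
  ∀ p ∈ openDomain n, ∃ M : ℝ, ∀ᶠ q in 𝓝 p, |u q.1 q.2| ≤ M

/-- The time derivative of `φ` at `(x, t)`. -/
def timeDeriv {n : ℕ} (φ : Space n × ℝ → ℝ) (x : Space n) (t : ℝ) : ℝ :=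
  deriv (fun s => φ (x, s)) t

/-- The spatial gradient of `φ` at `(x, t)`. -/
def spaceGrad {n : ℕ} (φ : Space n × ℝ → ℝ) (x : Space n) (t : ℝ) : Space n :=
  gradient (fun y => φ (y, t)) x

/-- Viscosity subsolutions of `u_t + |∇u| f(u, μ({u(·, t) < u(x, t)})) = 0` in
`ℝⁿ × (0, ∞)`. -/
structure IsViscositySubsolution {n : ℕ} (f : ℝ → ℝ≥0 → ℝ) (Θ : Space n → ℝ)
    (u : Space n → ℝ → ℝ) : Prop where
  locallyBounded : LocallyBounded u
  upperSemicontinuousOn :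
    UpperSemicontinuousOn (fun p : Space n × ℝ => u p.1 p.2) (openDomain n)
  test : ∀ (x₀ : Space n) (t₀ : ℝ) (φ : Space n × ℝ → ℝ), 0 < t₀ →
    ContDiffOn ℝ 1 φ (openDomain n) →
    IsLocalMax (fun p : Space n × ℝ => u p.1 p.2 - φ p) (x₀, t₀) →
    timeDeriv φ x₀ t₀ +
      ‖spaceGrad φ x₀ t₀‖ * f (u x₀ t₀) (mass Θ {y | u y t₀ < u x₀ t₀}) ≤ 0

/-- Viscosity supersolutions of the same equation; as usual for such nonlocal equations, the
sublevel set in the nonlocal term is the one with the non-strict inequality. -/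
structure IsViscositySupersolution {n : ℕ} (f : ℝ → ℝ≥0 → ℝ) (Θ : Space n → ℝ)
    (u : Space n → ℝ → ℝ) : Prop where
  locallyBounded : LocallyBounded u
  lowerSemicontinuousOn :
    LowerSemicontinuousOn (fun p : Space n × ℝ => u p.1 p.2) (openDomain n)
  test : ∀ (x₀ : Space n) (t₀ : ℝ) (φ : Space n × ℝ → ℝ), 0 < t₀ →
    ContDiffOn ℝ 1 φ (openDomain n) →
    IsLocalMin (fun p : Space n × ℝ => u p.1 p.2 - φ p) (x₀, t₀) →
    0 ≤ timeDeriv φ x₀ t₀ +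
      ‖spaceGrad φ x₀ t₀‖ * f (u x₀ t₀) (mass Θ {y | u y t₀ ≤ u x₀ t₀})

/-- `u ∈ C(ℝⁿ × [0, ∞))` is a viscosity solution of the equation in `ℝⁿ × (0, ∞)` with
`u(·, 0) = u₀`. The values of `u` at negative times play no role. -/
structure IsSolution {n : ℕ} (f : ℝ → ℝ≥0 → ℝ) (Θ : Space n → ℝ) (u₀ : Space n → ℝ)
    (u : Space n → ℝ → ℝ) : Prop where
  continuousOn : ContinuousOn (fun p : Space n × ℝ => u p.1 p.2) (univ ×ˢ Ici 0)
  subsolution : IsViscositySubsolution f Θ u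
  supersolution : IsViscositySupersolution f Θ u
  initial : ∀ x, u x 0 = u₀ x

/-- For every `T > 0`, `|u(x, t)| ≤ M_T (|x| + 1)` on `ℝⁿ × [0, T]`. -/
def LinearGrowth {n : ℕ} (u : Space n → ℝ → ℝ) : Prop :=
  ∀ T : ℝ, 0 < T → ∃ M : ℝ, 0 < M ∧ ∀ (x : Space n) (t : ℝ), t ∈ Icc 0 T →
    |u x t| ≤ M * (‖x‖ + 1)

/-- `hbar` is the critical level: `f(hbar, μ(D_hbar(0))) ≤ 0 ≤ f(hbar, μ(E_hbar(0)))`. -/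
def IsCriticalLevel {n : ℕ} (f : ℝ → ℝ≥0 → ℝ) (Θ : Space n → ℝ) (u₀ : Space n → ℝ)
    (hbar : ℝ) : Prop :=
  f hbar (mass Θ (sublevelD u₀ hbar)) ≤ 0 ∧ 0 ≤ f hbar (mass Θ (sublevelE u₀ hbar))

/-- `limsup_{s → 0+} f(hbar, μ(D_hbar(-s))) / s < 0`. The upper limit is taken in the extended
reals, since it may be `-∞`. -/
def NondegenerateBelow {n : ℕ} (f : ℝ → ℝ≥0 → ℝ) (Θ : Space n → ℝ) (u₀ : Space n → ℝ)
    (hbar : ℝ) : Prop :=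
  limsup (fun s : ℝ => ((f hbar (mass Θ (parallelD u₀ hbar (-s))) / s : ℝ) : EReal))
    (𝓝[>] (0 : ℝ)) < 0

/-- For all sufficiently small `b > 0` there is `a > 0` such that
`f(h, μ(E_h(s))) - f(h, μ(E_h(0))) ≥ a s` for all `hbar ≤ h ≤ hbar + b` and `0 ≤ s ≤ 1 / b`. -/
def UniformGrowthAbove {n : ℕ} (f : ℝ → ℝ≥0 → ℝ) (Θ : Space n → ℝ) (u₀ : Space n → ℝ)
    (hbar : ℝ) : Prop :=
  ∃ b₀ : ℝ, 0 < b₀ ∧ ∀ b : ℝ, 0 < b → b < b₀ → ∃ a : ℝ, 0 < a ∧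
    ∀ h ∈ Icc hbar (hbar + b), ∀ s ∈ Icc 0 (1 / b),
      a * s ≤ f h (mass Θ (parallelE u₀ h s)) - f h (mass Θ (sublevelE u₀ h))

end NonlocalHJ

end

namespace NonlocalHJ

/-! The level sets of `u` move with a normal velocity governed by the mass they enclose. Around
`E_hbar(0)`, a front at distance `s` encloses at least the mass of the parallel set, so criticality
and the growth condition push it outwards with speed at least `a * s`. A front at depth `s` inside
`D_hbar(0)` is pushed inwards with speed at least `c * s`. Such a front needs time `T` to travel
from distance `R * exp (-(a * T))` to a distance of order `R`. At time `0` and within that first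
distance, `u₀` exceeds `hbar` by at most `g (R * exp (-(a * T)))`. Following that level, which
depends on `T`, gives the upper bound at time `T`; the lower bound is the same argument for `-u` and
the complement of `D_hbar(0)`.

The motion is made rigorous by `le_of_barrier`, without a general comparison principle. A maximum of
`v` minus an increasing function of the distance `d` to a fixed set has two uses. Freezing a nearest
point turns the barrier into a smooth test function, and maximality forces `v` to be smaller at
every point with smaller `d`. The latter compares the nonlocal sublevel set with a parallel set of
the initial one. `le_of_exp_barrier` inserts the exponential front, and `IsSolution.le_add_modulus`
and `IsSolution.sub_modulus_le` supply the velocity bounds. -/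

/-! ### Barriers built from the distance to a closed set -/

/-- The time derivative of a power of a paraboloid with time dependent coefficients. -/
theorem timeDeriv_paraboloid_pow {n : ℕ} (y₀ x : Space n) (h N : ℝ) (k : ℕ) {p m : ℝ → ℝ}
    (t : ℝ) (hp : DifferentiableAt ℝ p t) (hm : DifferentiableAt ℝ m t) :
    timeDeriv (fun z : Space n × ℝ => h + N * (p z.2 * ‖z.1 - y₀‖ ^ 2 + m z.2) ^ k) x t =
      N * (k * (p t * ‖x - y₀‖ ^ 2 + m t) ^ (k - 1)) *
        (deriv p t * ‖x - y₀‖ ^ 2 + deriv m t) := by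
  have h1 := ((((hp.hasDerivAt.mul_const (‖x - y₀‖ ^ 2)).add hm.hasDerivAt).pow k).const_mul
    N).const_add h
  refine h1.deriv.trans ?_
  simp only [Pi.add_apply]
  ring

/-- The spatial gradient of a power of a paraboloid with time dependent coefficients. -/
theorem spaceGrad_paraboloid_pow {n : ℕ} (y₀ x : Space n) (h N : ℝ) (k : ℕ) (p m : ℝ → ℝ)
    (t : ℝ) :
    spaceGrad (fun z : Space n × ℝ => h + N * (p z.2 * ‖z.1 - y₀‖ ^ 2 + m z.2) ^ k) x t =
      (N * (k * (p t * ‖x - y₀‖ ^ 2 + m t) ^ (k - 1)) * (2 * p t)) • (x - y₀) := by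
  have h0 : HasFDerivAt (fun y : Space n => ‖y - y₀‖ ^ 2) (2 • innerSL ℝ (x - y₀)) x := by
    have := (hasStrictFDerivAt_norm_sq (x - y₀)).hasFDerivAt.comp x
      ((hasFDerivAt_id x).sub_const y₀)
    simpa [Function.comp_def] using this
  have h1 := ((((h0.const_mul (p t)).add_const (m t)).pow k).const_mul N).const_add h
  refine (hasGradientAt_iff_hasFDerivAt.2 (h1.congr_fderiv ?_)).gradient
  ext w
  simp
  ring

/-- Comparison with barriers that depend on the distance to a closed set only. The function `v`
is tested from above, and `F` is the speed in its equation `v_t ≤ |∇v| F`. -/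
theorem le_of_barrier {n : ℕ} {v F : Space n → ℝ → ℝ} {A B : Set (Space n)} {p m : ℝ → ℝ}
    {h S : ℝ} (hS : 0 < S)
    (hv : ContinuousOn (fun z : Space n × ℝ => v z.1 z.2) (univ ×ˢ Ici 0))
    (htest : ∀ (x₀ : Space n) (t₀ : ℝ) (φ : Space n × ℝ → ℝ), 0 < t₀ → ContDiff ℝ 1 φ →
      IsLocalMax (fun z : Space n × ℝ => v z.1 z.2 - φ z) (x₀, t₀) →
      timeDeriv φ x₀ t₀ ≤ ‖spaceGrad φ x₀ t₀‖ * F x₀ t₀)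
    (hA : IsClosed A) (hA' : A.Nonempty) (hB : IsCompact B)
    (hp : ContDiff ℝ 1 p) (hm : ContDiff ℝ 1 m) (hp0 : ∀ t, 0 ≤ t → 0 < p t)
    (hm0 : ∀ t, 0 ≤ t → 0 < m t) (hmS : 1 ≤ m S)
    (hinit : ∀ x ∈ B, v x 0 ≤ h ∨ 1 ≤ p 0 * Metric.infDist x A ^ 2 + m 0)
    (hlat : ∀ x ∈ B, x ∉ interior B → ∀ t ∈ Icc 0 S,
      v x t ≤ h ∨ 1 ≤ p t * Metric.infDist x A ^ 2 + m t)
    (hF : ∀ x ∈ interior B, ∀ t ∈ Ioo 0 S, h < v x t →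
      (∀ y ∈ B, Metric.infDist y A < Metric.infDist x A → v y t < v x t) →
      F x t * (2 * p t * Metric.infDist x A) <
        deriv p t * Metric.infDist x A ^ 2 + deriv m t)
    {x : Space n} (hx : x ∈ B) {t : ℝ} (ht : t ∈ Icc 0 S)
    (hxt : p t * Metric.infDist x A ^ 2 + m t < 1) : v x t ≤ h := by
  set d : Space n → ℝ := fun y => Metric.infDist y A with hd
  have hdc : Continuous d := Metric.continuous_infDist_pt A
  have hd0 : ∀ y, 0 ≤ d y := fun y => Metric.infDist_nonneg
  have hQ : IsCompact (B ×ˢ Icc (0 : ℝ) S) := hB.prod isCompact_Icc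
  have hvQ : ContinuousOn (fun z : Space n × ℝ => v z.1 z.2) (B ×ˢ Icc (0 : ℝ) S) :=
    hv.mono (prod_mono (subset_univ _) Icc_subset_Ici_self)
  -- With this `N` the barrier dominates `v` wherever its base `p * d ^ 2 + m` is at least `1`.
  obtain ⟨N, hN, hvN⟩ : ∃ N : ℝ, 0 < N ∧ ∀ y ∈ B, ∀ s ∈ Icc 0 S, v y s ≤ h + N := by
    obtain ⟨M, hM⟩ := (hQ.image_of_continuousOn hvQ).bddAbove
    refine ⟨max (M - h) 1, lt_max_of_lt_right one_pos, fun y hy s hs => ?_⟩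
    have h1 : v y s ≤ M := hM ⟨(y, s), ⟨hy, hs⟩, rfl⟩
    linarith [le_max_left (M - h) 1]
  have hqpos : ∀ (y : Space n) (s : ℝ), 0 ≤ s → 0 < p s * d y ^ 2 + m s := fun y s hs =>
    add_pos_of_nonneg_of_pos (mul_nonneg (hp0 s hs).le (sq_nonneg _)) (hm0 s hs)
  have key : ∀ k : ℕ, 1 ≤ k → v x t ≤ h + N * (p t * d x ^ 2 + m t) ^ k := by
    intro k hk
    have hk0 : k ≠ 0 := by omega
    set W : Space n × ℝ → ℝ := fun z => h + N * (p z.2 * d z.1 ^ 2 + m z.2) ^ k with hW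
    have hWc : Continuous W := by
      have := hp.continuous
      have := hm.continuous
      fun_prop
    by_contra! hcon
    obtain ⟨⟨x₀, t₀⟩, ⟨hx₀, ht₀⟩, hmax⟩ := hQ.exists_isMaxOn ⟨(x, t), hx, ht⟩
      (hvQ.sub hWc.continuousOn)
    simp only at hx₀ ht₀
    have hmax' : ∀ y ∈ B, ∀ s ∈ Icc 0 S, v y s - W (y, s) ≤ v x₀ t₀ - W (x₀, t₀) :=
      fun y hy s hs => hmax (show (y, s) ∈ B ×ˢ Icc (0 : ℝ) S from ⟨hy, hs⟩)
    have hpos : W (x₀, t₀) < v x₀ t₀ := by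
      have := hmax' x hx t ht
      have h2 : W (x, t) < v x t := hcon
      linarith
    have hWh : h < W (x₀, t₀) :=
      lt_add_of_pos_right _ (mul_pos hN (pow_pos (hqpos x₀ t₀ ht₀.1) k))
    have hnot : ¬ (v x₀ t₀ ≤ h ∨ 1 ≤ p t₀ * d x₀ ^ 2 + m t₀) := by
      rintro (h1 | h1)
      · linarith
      · have h2 := hvN x₀ hx₀ t₀ ht₀
        have h3 : N ≤ N * (p t₀ * d x₀ ^ 2 + m t₀) ^ k :=
          le_mul_of_one_le_right hN.le (one_le_pow₀ h1)
        have h4 : W (x₀, t₀) = h + N * (p t₀ * d x₀ ^ 2 + m t₀) ^ k := rfl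
        linarith
    have hint : x₀ ∈ interior B := by
      by_contra hni
      exact hnot (hlat x₀ hx₀ hni t₀ ht₀)
    have ht1 : 0 < t₀ := by
      refine ht₀.1.lt_of_ne fun h0 => hnot ?_
      rw [← h0]
      exact hinit x₀ hx₀
    have ht2 : t₀ < S := by
      refine ht₀.2.lt_of_ne fun h0 => hnot (Or.inr ?_)
      rw [h0]
      exact hmS.trans (le_add_of_nonneg_left
        (mul_nonneg (hp0 S hS.le).le (sq_nonneg _)))
    -- The distance `d` need not be differentiable. Replacing it by the distance to one nearest
    -- point raises the barrier, with equality at the maximum, so the maximum survives.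
    obtain ⟨y₀, hy₀, hdy₀⟩ := hA.exists_infDist_eq_dist hA' x₀
    rw [dist_eq_norm] at hdy₀
    have hdy : d x₀ = ‖x₀ - y₀‖ := hdy₀
    set φ : Space n × ℝ → ℝ := fun z => h + N * (p z.2 * ‖z.1 - y₀‖ ^ 2 + m z.2) ^ k with hφ
    have hφc : ContDiff ℝ 1 φ := by
      have h1 : ContDiff ℝ 1 fun z : Space n × ℝ => ‖z.1 - y₀‖ ^ 2 :=
        (contDiff_fst.sub contDiff_const).norm_sq ℝ
      exact contDiff_const.add (contDiff_const.mul
        ((((hp.comp contDiff_snd).mul h1).add (hm.comp contDiff_snd)).pow k))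
    have hloc : IsLocalMax (fun z : Space n × ℝ => v z.1 z.2 - φ z) (x₀, t₀) := by
      have hnhds : B ×ˢ Icc (0 : ℝ) S ∈ 𝓝 (x₀, t₀) :=
        prod_mem_nhds (mem_interior_iff_mem_nhds.1 hint) (Icc_mem_nhds ht1 ht2)
      filter_upwards [hnhds] with z hz
      have h1 := hmax' z.1 hz.1 z.2 hz.2
      have h2 : W (z.1, z.2) ≤ φ z := by
        have h3 : d z.1 ≤ ‖z.1 - y₀‖ := by
          rw [← dist_eq_norm]
          exact Metric.infDist_le_dist_of_mem hy₀
        have h4 : 0 ≤ p z.2 := (hp0 _ hz.2.1).le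
        have h5 := (hqpos z.1 z.2 hz.2.1).le
        have h6 := hd0 z.1
        simp only [hW, hφ]
        gcongr
      have h3 : W (x₀, t₀) = φ (x₀, t₀) := by simp only [hW, hφ, hdy]
      linarith
    have htst := htest x₀ t₀ φ ht1 hφc hloc
    rw [timeDeriv_paraboloid_pow y₀ x₀ h N k t₀ (hp.differentiable one_ne_zero t₀)
      (hm.differentiable one_ne_zero t₀), spaceGrad_paraboloid_pow, norm_smul, ← hdy] at htst
    have hc : 0 < N * (k * (p t₀ * d x₀ ^ 2 + m t₀) ^ (k - 1)) :=
      mul_pos hN (mul_pos (by exact_mod_cast hk) (pow_pos (hqpos x₀ t₀ ht₀.1) _))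
    have hpp := hp0 t₀ ht₀.1
    rw [Real.norm_of_nonneg (by positivity)] at htst
    -- The barrier increases with `d`, so at a maximum of `v - W` every point of `B` closer to `A`
    -- has a smaller value of `v`.
    have hlt := hF x₀ hint t₀ ⟨ht1, ht2⟩ (hWh.trans hpos) fun y hy hyd => by
      have h1 := hmax' y hy t₀ ht₀
      have h2 : W (y, t₀) < W (x₀, t₀) := by
        have h5 := (hqpos y t₀ ht₀.1).le
        have h6 := hd0 y
        have h7 : d y < d x₀ := hyd
        simp only [hW]
        gcongr
      linarith
    have := mul_lt_mul_of_pos_left hlt hc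
    change _ < _ * (deriv p t₀ * d x₀ ^ 2 + deriv m t₀) at this
    change _ * (F x₀ t₀ * (2 * p t₀ * d x₀)) < _ at this
    linarith
  -- As the power grows, the barrier collapses to `h` where the base is below `1`.
  have hlim : Tendsto (fun k : ℕ => h + N * (p t * d x ^ 2 + m t) ^ k) atTop
      (𝓝 (h + N * 0)) :=
    ((tendsto_pow_atTop_nhds_zero_of_lt_one (hqpos x t ht.1).le hxt).const_mul N).const_add h
  rw [mul_zero, add_zero] at hlim
  exact ge_of_tendsto hlim ((eventually_ge_atTop 1).mono key)

/-! ### Monotonicity and testing from above -/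

theorem mass_mono {n : ℕ} {Θ : Space n → ℝ} (hΘ : PositiveDensity Θ) {A B : Set (Space n)}
    (hAB : A ⊆ B) : mass Θ A ≤ mass Θ B := by
  have : IsFiniteMeasure (volume.withDensity fun x => ENNReal.ofReal (Θ x)) :=
    isFiniteMeasure_withDensity_ofReal hΘ.integrable.2
  exact ENNReal.toNNReal_mono (measure_ne_top _ _) (measure_mono hAB)

theorem MonotoneNonlinearity.mono {f : ℝ → ℝ≥0 → ℝ} (hf : MonotoneNonlinearity f)
    {r₁ r₂ : ℝ} {q₁ q₂ : ℝ≥0} (hr : r₁ ≤ r₂) (hq : q₁ ≤ q₂) : f r₁ q₁ ≤ f r₂ q₂ := by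
  have h1 : f r₁ q₁ ≤ f r₂ q₁ := by
    rcases hr.eq_or_lt with rfl | h
    · exact le_rfl
    · exact hf.mono_left _ _ _ h
  exact h1.trans ((show StrictMono (f r₂) from fun _ _ h => hf.strictMono_right _ _ _ h).monotone
    hq)

theorem IsViscositySubsolution.test_above {n : ℕ} {f : ℝ → ℝ≥0 → ℝ} {Θ : Space n → ℝ}
    {u : Space n → ℝ → ℝ} (hu : IsViscositySubsolution f Θ u) (x₀ : Space n) (t₀ : ℝ)
    (φ : Space n × ℝ → ℝ) (ht₀ : 0 < t₀) (hφ : ContDiff ℝ 1 φ)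
    (hmax : IsLocalMax (fun z : Space n × ℝ => u z.1 z.2 - φ z) (x₀, t₀)) :
    timeDeriv φ x₀ t₀ ≤
      ‖spaceGrad φ x₀ t₀‖ * (-f (u x₀ t₀) (mass Θ {y | u y t₀ < u x₀ t₀})) := by
  have := hu.test x₀ t₀ φ ht₀ hφ.contDiffOn hmax
  linarith

/-- The negative of a supersolution, tested from above. -/
theorem IsViscositySupersolution.neg_test_above {n : ℕ} {f : ℝ → ℝ≥0 → ℝ} {Θ : Space n → ℝ}
    {u : Space n → ℝ → ℝ} (hu : IsViscositySupersolution f Θ u) (x₀ : Space n) (t₀ : ℝ)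
    (φ : Space n × ℝ → ℝ) (ht₀ : 0 < t₀) (hφ : ContDiff ℝ 1 φ)
    (hmax : IsLocalMax (fun z : Space n × ℝ => -u z.1 z.2 - φ z) (x₀, t₀)) :
    timeDeriv φ x₀ t₀ ≤
      ‖spaceGrad φ x₀ t₀‖ * f (u x₀ t₀) (mass Θ {y | u y t₀ ≤ u x₀ t₀}) := by
  have h1 := hu.test x₀ t₀ (fun z => -φ z) ht₀ hφ.neg.contDiffOn (by
    have := hmax.neg
    refine this.congr (Eventually.of_forall fun z => ?_)
    simp only
    ring)
  have h2 : timeDeriv (fun z => -φ z) x₀ t₀ = -timeDeriv φ x₀ t₀ := deriv.fun_neg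
  have h3 : ‖spaceGrad (fun z => -φ z) x₀ t₀‖ = ‖spaceGrad φ x₀ t₀‖ := by
    simp only [spaceGrad, gradient, LinearIsometryEquiv.norm_map]
    rw [fderiv_fun_neg, norm_neg]
  rw [h2, h3] at h1
  linarith

/-! ### Finite speed of propagation -/

/-- Finite speed of propagation: `u` stays above `h` far away from the origin. -/
theorem IsSolution.ge_of_norm_ge {n : ℕ} {f : ℝ → ℝ≥0 → ℝ} {Θ u₀ : Space n → ℝ}
    {u : Space n → ℝ → ℝ} (hf : RegularNonlinearity f) (hu : IsSolution f Θ u₀ u) {h R : ℝ}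
    (hR : ∀ y, R ≤ ‖y‖ → h ≤ u₀ y) {S : ℝ} (hS : 0 < S) :
    ∃ R' : ℝ, ∀ x, R' ≤ ‖x‖ → ∀ t ∈ Icc 0 S, h ≤ u x t := by
  obtain ⟨M, hM⟩ := hf.bounded
  have hM0 : 0 ≤ M := (abs_nonneg _).trans (hM 0 0)
  -- Large enough that `2 * M / r < 1 / (2 * (S + 1))`, so the barrier rises faster than the speed
  -- bound `M` requires. Using `S + 1` keeps `m < 1` up to time `S` itself.
  set r : ℝ := (4 * M + 1) * (S + 1) with hr
  have hr0 : 0 < r := by positivity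
  have hpd : ∀ t : ℝ, HasDerivAt (fun t : ℝ => (1 + t / (S + 1)) / 2) (1 / (S + 1) / 2) t :=
    fun t => (((hasDerivAt_id t).div_const _).const_add 1).div_const 2
  refine ⟨R + r, fun x hx t ht => ?_⟩
  have hball : ∀ y ∈ Metric.closedBall x r, h ≤ u₀ y := fun y hy => hR y (by
    rw [Metric.mem_closedBall, dist_comm, dist_eq_norm] at hy
    have := norm_sub_norm_le x y
    linarith)
  have := le_of_barrier (v := fun x t => -u x t)
    (F := fun x t => f (u x t) (mass Θ {y | u y t ≤ u x t})) (A := {x})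
    (B := Metric.closedBall x r) (p := fun _ => 1 / r ^ 2)
    (m := fun t => (1 + t / (S + 1)) / 2) (h := -h) (S := S + 1) (by linarith)
    hu.continuousOn.neg
    (fun x₀ t₀ φ => hu.supersolution.neg_test_above x₀ t₀ φ) isClosed_singleton
    (singleton_nonempty x) (isCompact_closedBall x r) contDiff_const (by fun_prop)
    (fun _ _ => by positivity) (fun s hs => by positivity)
    (by rw [div_self (by positivity)]; norm_num)
    (fun y hy => Or.inl (by rw [hu.initial]; exact neg_le_neg (hball y hy)))
    (fun y hy hy' s hs => Or.inr (by
      have h1 : r ≤ dist y x := by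
        by_contra! hlt
        exact hy' (Metric.ball_subset_interior_closedBall hlt)
      have h0 := hs.1
      have h2 : 1 ≤ 1 / r ^ 2 * dist y x ^ 2 := by
        rw [one_div, inv_mul_eq_div, one_le_div (by positivity)]
        gcongr
      rw [Metric.infDist_singleton]
      exact h2.trans (le_add_of_nonneg_right (by positivity))))
    (fun y hy s hs _ _ => by
      have h1 : dist y x ≤ r :=
        Metric.mem_closedBall.1 (interior_subset hy)
      have h2 := (abs_le.1 (hM (u y s) (mass Θ {z | u z s ≤ u y s}))).2
      rw [Metric.infDist_singleton, (hpd s).deriv, deriv_const, zero_mul, zero_add]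
      calc _ ≤ M * (2 * (1 / r ^ 2) * r) := by gcongr
        _ = 2 * M / r := by field_simp
        _ < _ := by
          rw [hr, div_div, div_lt_div_iff₀ (by positivity) (by positivity)]
          nlinarith)
    (x := x) (Metric.mem_closedBall_self hr0.le) (t := t) ⟨ht.1, by linarith [ht.2]⟩
    (by
      have : t / (S + 1) < 1 := (div_lt_one (by linarith)).2 (by linarith [ht.2])
      simp only [Metric.infDist_singleton, dist_self]
      linarith)
  linarith

/-! ### Exponentially moving fronts -/

/-- Comparison with the exponentially moving barriers. -/
theorem le_of_exp_barrier {n : ℕ} {v F : Space n → ℝ → ℝ} {A B : Set (Space n)}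
    {h a R T : ℝ} (ha : 0 < a) (hR : 0 < R) (hT : 0 ≤ T)
    (hv : ContinuousOn (fun z : Space n × ℝ => v z.1 z.2) (univ ×ˢ Ici 0))
    (htest : ∀ (x₀ : Space n) (t₀ : ℝ) (φ : Space n × ℝ → ℝ), 0 < t₀ → ContDiff ℝ 1 φ →
      IsLocalMax (fun z : Space n × ℝ => v z.1 z.2 - φ z) (x₀, t₀) →
      timeDeriv φ x₀ t₀ ≤ ‖spaceGrad φ x₀ t₀‖ * F x₀ t₀)
    (hA : IsClosed A) (hA' : A.Nonempty) (hB : IsCompact B)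
    (hinit : ∀ x ∈ B, Metric.infDist x A ≤ R * Real.exp (-(a * T)) → v x 0 ≤ h)
    (hlat : ∀ x ∈ B, x ∉ interior B → ∀ t ∈ Icc 0 (T + Real.log 2 / (2 * a)),
      v x t ≤ h ∨ R ≤ Metric.infDist x A)
    (hF : ∀ x ∈ interior B, ∀ t ∈ Ioo 0 (T + Real.log 2 / (2 * a)), h < v x t →
      0 < Metric.infDist x A →
      (∀ y ∈ B, Metric.infDist y A < Metric.infDist x A → v y t < v x t) →
      F x t ≤ -(a * Metric.infDist x A))
    {x : Space n} (hx : x ∈ B) (hxR : Metric.infDist x A < R / 2) : v x T ≤ h := by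
  -- The extra time gives `p T = 2 / R ^ 2` and `m T = 1 / 2`, so at time `T` the barrier controls
  -- exactly the points with `d < R / 2`.
  set S : ℝ := T + Real.log 2 / (2 * a) with hS
  have hlog : 0 < Real.log 2 / (2 * a) := div_pos (Real.log_pos one_lt_two) (by positivity)
  have hTS : T < S := by linarith
  have hE : ∀ t, HasDerivAt (fun t : ℝ => Real.exp (2 * a * (S - t)) / R ^ 2)
      (-(2 * a) * (Real.exp (2 * a * (S - t)) / R ^ 2)) t := fun t => by
    refine (((((hasDerivAt_id t).const_sub S).const_mul (2 * a)).exp).div_const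
      (R ^ 2)).congr_deriv ?_
    simp only [id]
    ring
  have hm : ∀ t, HasDerivAt (fun t : ℝ => Real.exp (-(2 * a * (S - t))))
      (2 * a * Real.exp (-(2 * a * (S - t)))) t := fun t => by
    refine ((((hasDerivAt_id t).const_sub S).const_mul (2 * a)).neg).exp.congr_deriv ?_
    simp only [id, Pi.neg_apply]
    ring
  have hST : 2 * a * (S - T) = Real.log 2 := by
    rw [hS]; field_simp; ring
  refine le_of_barrier (p := fun t => Real.exp (2 * a * (S - t)) / R ^ 2)
    (m := fun t => Real.exp (-(2 * a * (S - t)))) (hT.trans_lt hTS) hv htest hA hA' hB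
    (by fun_prop) (by fun_prop) (fun _ _ => by positivity) (fun _ _ => by positivity)
    (by simp) (fun y hy => ?_) (fun y hy hy' s hs => ?_) (fun y hy s hs hys hlt => ?_) hx
    ⟨hT, hTS.le⟩ ?_
  · rw [or_iff_not_imp_right]
    intro hn
    refine hinit y hy ?_
    by_contra! hgt
    refine hn (le_add_of_le_of_nonneg ?_ (Real.exp_pos _).le)
    calc (1 : ℝ) ≤ Real.exp (2 * a * (S - 0)) / R ^ 2 * (R * Real.exp (-(a * T))) ^ 2 := by
          rw [mul_pow, ← Real.exp_nat_mul]
          have : Real.exp (2 * a * (S - 0)) / R ^ 2 *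
              (R ^ 2 * Real.exp ((2 : ℕ) * -(a * T))) =
              Real.exp (2 * a * (S - 0)) * Real.exp ((2 : ℕ) * -(a * T)) := by
            field_simp
          rw [this, ← Real.exp_add]
          refine Real.one_le_exp ?_
          push_cast
          nlinarith
      _ ≤ _ := by gcongr
  · refine (hlat y hy hy' s hs).imp_right fun h1 => ?_
    refine le_add_of_le_of_nonneg ?_ (Real.exp_pos _).le
    rw [div_mul_eq_mul_div, one_le_div (by positivity)]
    calc R ^ 2 ≤ 1 * Metric.infDist y A ^ 2 := by rw [one_mul]; gcongr
      _ ≤ _ := by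
        gcongr
        refine Real.one_le_exp (mul_nonneg (by positivity) (by linarith [hs.2]))
  · rw [(hE s).deriv, (hm s).deriv]
    -- The terms in `p` balance exactly against the speed bound `-(a * d)`; the strict inequality
    -- comes from `m' > 0`. At `d = 0` the gradient vanishes and no speed bound is needed.
    have hm1 : 0 < 2 * a * Real.exp (-(2 * a * (S - s))) := by positivity
    rcases (Metric.infDist_nonneg (x := y) (s := A)).eq_or_lt with h0 | h0
    · rw [← h0]
      simpa using hm1
    · have h1 := hF y hy s hs hys h0 hlt
      have h2 : 0 ≤ 2 * (Real.exp (2 * a * (S - s)) / R ^ 2) * Metric.infDist y A := by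
        positivity
      have := mul_le_mul_of_nonneg_right h1 h2
      nlinarith
  · rw [hST, Real.exp_neg, Real.exp_log two_pos]
    have h0 := Metric.infDist_nonneg (x := x) (s := A)
    have : Metric.infDist x A ^ 2 < (R / 2) ^ 2 := by gcongr
    rw [div_mul_eq_mul_div]
    have : 2 * Metric.infDist x A ^ 2 / R ^ 2 < 1 / 2 := by
      rw [div_lt_div_iff₀ (by positivity) two_pos]
      nlinarith
    linarith

/-! ### Parallel sets and nondegeneracy at the critical level -/

theorem infDist_le_of_mem_parallelE {n : ℕ} {u₀ : Space n → ℝ} {h s : ℝ} (hs : 0 ≤ s)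
    {y : Space n} (hy : y ∈ parallelE u₀ h s) : Metric.infDist y (sublevelE u₀ h) ≤ s := by
  by_cases hyE : y ∈ sublevelE u₀ h
  · rwa [Metric.infDist_zero_of_mem hyE]
  · have h1 : Metric.infEDist y (sublevelE u₀ h)ᶜ = 0 := Metric.infEDist_zero_of_mem hyE
    have h2 : ((Metric.infEDist y (sublevelE u₀ h) : ℝ≥0∞) : EReal) ≤ (s : EReal) := by
      have := hy
      rw [parallelE, mem_ofPred_eq, signedDistSet, h1] at this
      simpa using this
    have h3 : Metric.infEDist y (sublevelE u₀ h) ≤ ENNReal.ofReal s := by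
      rw [← EReal.coe_ennreal_le_coe_ennreal_iff, EReal.coe_ennreal_ofReal, max_eq_left hs]
      exact h2
    exact ENNReal.toReal_le_of_le_ofReal hs h3

theorem mem_parallelD_of_lt_infDist {n : ℕ} {u₀ : Space n → ℝ} {h s : ℝ} (hs : 0 ≤ s)
    {y : Space n} (hy : s < Metric.infDist y (sublevelD u₀ h)ᶜ) :
    y ∈ parallelD u₀ h (-s) := by
  have hyD : y ∈ sublevelD u₀ h := by
    by_contra hn
    rw [Metric.infDist_zero_of_mem hn] at hy
    exact hy.not_ge hs
  have h1 : Metric.infEDist y (sublevelD u₀ h) = 0 := Metric.infEDist_zero_of_mem hyD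
  have h2 : ENNReal.ofReal s < Metric.infEDist y (sublevelD u₀ h)ᶜ :=
    -- An infinite distance has real value `0` by convention, which `hy` excludes.
    (ENNReal.ofReal_lt_iff_lt_toReal hs (fun htop => by
      rw [Metric.infDist, htop] at hy
      exact hy.not_ge hs)).2 hy
  have h3 : (s : EReal) < (Metric.infEDist y (sublevelD u₀ h)ᶜ : EReal) := by
    rw [← EReal.coe_ennreal_lt_coe_ennreal_iff, EReal.coe_ennreal_ofReal, max_eq_left hs] at h2
    exact h2
  rw [parallelD, mem_ofPred_eq, signedDistSet, h1, EReal.coe_ennreal_zero, zero_sub,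
    EReal.coe_neg]
  exact EReal.neg_lt_neg_iff.2 h3

theorem parallelD_eq_univ {n : ℕ} {u₀ : Space n → ℝ} {h : ℝ} (hD : sublevelD u₀ h = univ)
    (s : ℝ) : parallelD u₀ h s = univ := by
  refine eq_univ_of_forall fun y => ?_
  rw [parallelD, mem_ofPred_eq, signedDistSet, hD, compl_univ, Metric.infEDist_empty,
    Metric.infEDist_zero_of_mem (mem_univ y)]
  simp

theorem parallelD_mono {n : ℕ} (u₀ : Space n → ℝ) (h : ℝ) {s₁ s₂ : ℝ} (hs : s₁ ≤ s₂) :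
    parallelD u₀ h s₁ ⊆ parallelD u₀ h s₂ := fun _ hx =>
  lt_of_lt_of_le hx (EReal.coe_le_coe_iff.2 hs)

theorem NondegenerateBelow.exists_le {n : ℕ} {f : ℝ → ℝ≥0 → ℝ} {Θ u₀ : Space n → ℝ} {h : ℝ}
    (hb : NondegenerateBelow f Θ u₀ h) :
    ∃ c > 0, ∃ δ > 0, ∀ s ∈ Ioo 0 δ, f h (mass Θ (parallelD u₀ h (-s))) ≤ -(c * s) := by
  obtain ⟨c, hc1, hc2⟩ := EReal.lt_iff_exists_real_btwn.1 hb
  have hev := eventually_lt_of_limsup_lt hc1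
  obtain ⟨δ, hδ, hs⟩ := mem_nhdsGT_iff_exists_Ioo_subset.1 hev
  refine ⟨-c, by simpa using hc2, δ, hδ, fun s hs' => ?_⟩
  have h1 := EReal.coe_lt_coe_iff.1 (hs hs')
  rw [div_lt_iff₀ hs'.1] at h1
  linarith

/-- The linear bound for small `s` propagates to bounded intervals by monotonicity. -/
theorem NondegenerateBelow.exists_le_of_lt {n : ℕ} {f : ℝ → ℝ≥0 → ℝ} {Θ u₀ : Space n → ℝ}
    {h : ℝ} (hb : NondegenerateBelow f Θ u₀ h) (hf : MonotoneNonlinearity f)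
    (hΘ : PositiveDensity Θ) {R : ℝ} (hR : 0 < R) :
    ∃ c > 0, ∀ s ∈ Ioo 0 R, f h (mass Θ (parallelD u₀ h (-s))) ≤ -(c * s) := by
  obtain ⟨c, hc, δ, hδ, hs⟩ := hb.exists_le
  refine ⟨min c (c * (δ / 2) / R), lt_min hc (by positivity), fun s hs' => ?_⟩
  have hs0 := hs'.1
  rcases lt_or_ge s δ with h1 | h1
  · refine (hs s ⟨hs0, h1⟩).trans (neg_le_neg ?_)
    gcongr
    exact min_le_left _ _
  · calc f h (mass Θ (parallelD u₀ h (-s)))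
        ≤ f h (mass Θ (parallelD u₀ h (-(δ / 2)))) :=
          hf.mono le_rfl (mass_mono hΘ (parallelD_mono _ _ (by linarith)))
      _ ≤ -(c * (δ / 2)) := hs _ ⟨by linarith, by linarith⟩
      _ ≤ -(c * (δ / 2) / R * s) := by
          refine neg_le_neg ?_
          rw [div_mul_eq_mul_div, div_le_iff₀ hR]
          gcongr
          exact hs'.2.le
      _ ≤ _ := by
          refine neg_le_neg ?_
          gcongr
          exact min_le_right _ _

theorem sublevelD_subset_sublevelE {n : ℕ} (u₀ : Space n → ℝ) (h : ℝ) :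
    sublevelD u₀ h ⊆ sublevelE u₀ h := fun x hx => by
  have : u₀ x < h := hx
  exact this.le

/-- Nondegeneracy makes `f` negative at some mass. An empty set would have the smallest mass, where
criticality makes `f` nonnegative, against monotonicity. -/
theorem IsCriticalLevel.sublevelE_nonempty {n : ℕ} {f : ℝ → ℝ≥0 → ℝ} {Θ u₀ : Space n → ℝ}
    {h : ℝ} (hc : IsCriticalLevel f Θ u₀ h) (hb : NondegenerateBelow f Θ u₀ h)
    (hf : MonotoneNonlinearity f) (hΘ : PositiveDensity Θ) : (sublevelE u₀ h).Nonempty := by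
  by_contra hn
  obtain ⟨c, hc0, δ, hδ, hs⟩ := hb.exists_le
  have h1 := hs (δ / 2) ⟨by linarith, by linarith⟩
  have h2 := hc.2
  rw [not_nonempty_iff_eq_empty.1 hn] at h2
  have h3 := hf.mono (le_refl h) (mass_mono hΘ (empty_subset (parallelD u₀ h (-(δ / 2)))))
  have : 0 < c * (δ / 2) := by positivity
  linarith

/-- If `D_h(0)` were everything, so would be its inner parallel sets, and `f` at the total mass
would be both negative and nonnegative. -/
theorem IsCriticalLevel.compl_sublevelD_nonempty {n : ℕ} {f : ℝ → ℝ≥0 → ℝ}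
    {Θ u₀ : Space n → ℝ} {h : ℝ} (hc : IsCriticalLevel f Θ u₀ h)
    (hb : NondegenerateBelow f Θ u₀ h) : (sublevelD u₀ h)ᶜ.Nonempty := by
  rw [nonempty_compl]
  intro hD
  obtain ⟨c, hc0, δ, hδ, hs⟩ := hb.exists_le
  have h1 := hs (δ / 2) ⟨by linarith, by linarith⟩
  have h2 := hc.2
  have hE : sublevelE u₀ h = univ := univ_subset_iff.1 (hD ▸ sublevelD_subset_sublevelE u₀ h)
  rw [hE] at h2
  rw [parallelD_eq_univ hD] at h1
  have : 0 < c * (δ / 2) := by positivity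
  linarith

theorem IsModulus.nonneg {g : ℝ → ℝ} (hg : IsModulus g) {r : ℝ} (hr : 0 ≤ r) : 0 ≤ g r := by
  rw [← hg.zero]
  exact hg.strictMonoOn.monotoneOn self_mem_Ici hr hr

/-! ### Exponential upper and lower bounds -/

/-- The sublevel sets above the critical level expand exponentially fast. -/
theorem IsSolution.le_add_modulus {n : ℕ} {f : ℝ → ℝ≥0 → ℝ} {Θ u₀ : Space n → ℝ}
    {u : Space n → ℝ → ℝ} (hf : MonotoneNonlinearity f) (hΘ : PositiveDensity Θ)
    (hu₀ : Continuous u₀) (hu : IsSolution f Θ u₀ u) {h a R : ℝ} (ha : 0 < a) (hR : 0 < R)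
    (hE : (sublevelE u₀ h).Nonempty) (hEb : Bornology.IsBounded (sublevelE u₀ h))
    (hgrowth : ∀ s ∈ Icc 0 R, a * s ≤ f h (mass Θ (parallelE u₀ h s)))
    {g : ℝ → ℝ} (hg : IsModulusOfContinuity u₀ g) {T : ℝ} (hT : 0 ≤ T) {x : Space n}
    (hx : Metric.infDist x (sublevelE u₀ h) < R / 2) :
    u x T ≤ h + g (R * Real.exp (-(a * T))) := by
  have hEc : IsClosed (sublevelE u₀ h) := isClosed_le hu₀ continuous_const
  have hdc : Continuous fun y => Metric.infDist y (sublevelE u₀ h) :=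
    Metric.continuous_infDist_pt _
  have hg0 : 0 ≤ g (R * Real.exp (-(a * T))) := hg.isModulus.nonneg (by positivity)
  set B : Set (Space n) := {y | Metric.infDist y (sublevelE u₀ h) ≤ R} with hB
  have hBc : IsCompact B := by
    refine Metric.isCompact_of_isClosed_isBounded (isClosed_le hdc continuous_const) ?_
    refine (hEb.cthickening (δ := R)).subset fun y hy => ?_
    obtain ⟨z, hz, hyz⟩ := hEc.exists_infDist_eq_dist hE y
    exact Metric.mem_cthickening_of_dist_le y z R _ hz (hyz ▸ hy)
  refine le_of_exp_barrier (F := fun x t => -f (u x t) (mass Θ {y | u y t < u x t}))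
    (B := B) ha hR hT hu.continuousOn (fun x₀ t₀ φ => hu.subsolution.test_above x₀ t₀ φ)
    hEc hE hBc (fun y _ hyd => ?_) (fun y _ hy' t _ => Or.inr ?_)
    (fun y hy t ht hyt hy0 hlt => ?_) (by simp only [hB, mem_ofPred_eq]; linarith) hx
  · obtain ⟨z, hz, hyz⟩ := hEc.exists_infDist_eq_dist hE y
    have h1 := (abs_le.1 (hg.le y z)).2
    have h2 : g (dist y z) ≤ g (R * Real.exp (-(a * T))) :=
      hg.isModulus.strictMonoOn.monotoneOn dist_nonneg
        (show (0 : ℝ) ≤ R * Real.exp (-(a * T)) by positivity) (hyz ▸ hyd)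
    have h3 : u₀ z ≤ h := hz
    rw [hu.initial]
    linarith
  · by_contra! hlt
    exact hy' (interior_maximal (fun z hz => le_of_lt hz)
      (isOpen_lt hdc continuous_const) hlt)
  · have hyR : Metric.infDist y (sublevelE u₀ h) ≤ R :=
      (interior_subset hy : y ∈ B)
    refine neg_le_neg ?_
    -- `hlt` controls only points strictly closer than `y`, while `E_h(s)` includes distance `s`.
    -- Hence the growth bound is used for `s < d y` and `s` tends to `d y`.
    refine le_of_forall_lt fun r hr => ?_
    have hr' : r / a < Metric.infDist y (sublevelE u₀ h) := (div_lt_iff₀' ha).2 hr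
    obtain ⟨s, hs1, hs2⟩ := exists_between (max_lt hr' hy0)
    have hs0 : 0 < s := (le_max_right _ _).trans_lt hs1
    have hrs : r < a * s := (div_lt_iff₀' ha).1 ((le_max_left _ _).trans_lt hs1)
    refine hrs.trans_le ((hgrowth s ⟨hs0.le, by linarith⟩).trans
      (hf.mono (by linarith) (mass_mono hΘ fun z hz => ?_)))
    have hzd := (infDist_le_of_mem_parallelE hs0.le hz).trans_lt hs2
    exact hlt z (hzd.le.trans hyR) hzd

/-- The sublevel sets below the critical level shrink and vanish exponentially fast. -/
theorem IsSolution.sub_modulus_le {n : ℕ} {f : ℝ → ℝ≥0 → ℝ} {Θ u₀ : Space n → ℝ}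
    {u : Space n → ℝ → ℝ} (hf_reg : RegularNonlinearity f) (hf : MonotoneNonlinearity f)
    (hΘ : PositiveDensity Θ) (hu₀ : Continuous u₀) (hu : IsSolution f Θ u₀ u)
    {h c R R₀ : ℝ} (hc : 0 < c) (hR : 0 < R)
    (hR₀ : ∀ y, R₀ ≤ ‖y‖ → h ≤ u₀ y) (hD : (sublevelD u₀ h)ᶜ.Nonempty)
    (hDR : ∀ y, Metric.infDist y (sublevelD u₀ h)ᶜ < R / 2)
    (hdecay : ∀ s ∈ Ioo 0 R, f h (mass Θ (parallelD u₀ h (-s))) ≤ -(c * s))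
    {g : ℝ → ℝ} (hg : IsModulusOfContinuity u₀ g) {T : ℝ} (hT : 0 ≤ T) (x : Space n) :
    h - g (R * Real.exp (-(c * T))) ≤ u x T := by
  have hDc : IsClosed (sublevelD u₀ h)ᶜ := (isOpen_lt hu₀ continuous_const).isClosed_compl
  have hg0 : 0 ≤ g (R * Real.exp (-(c * T))) := hg.isModulus.nonneg (by positivity)
  have hlog : 0 < Real.log 2 / (2 * c) := div_pos (Real.log_pos one_lt_two) (by positivity)
  -- The complement of `D_h(0)` is unbounded, so the comparison runs in a large ball outside which
  -- `u` stays above `h` throughout.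
  obtain ⟨R', hR'⟩ := hu.ge_of_norm_ge hf_reg hR₀ (S := T + Real.log 2 / (2 * c))
    (by linarith)
  have := le_of_exp_barrier (v := fun x t => -u x t)
    (F := fun x t => f (u x t) (mass Θ {y | u y t ≤ u x t}))
    (h := -(h - g (R * Real.exp (-(c * T)))))
    (B := Metric.closedBall 0 (max R' ‖x‖)) hc hR hT hu.continuousOn.neg
    (fun x₀ t₀ φ => hu.supersolution.neg_test_above x₀ t₀ φ) hDc hD
    (isCompact_closedBall _ _) (fun y _ hyd => ?_) (fun y _ hy' t ht => Or.inl ?_)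
    (fun y hy t ht hyt hy0 hlt => ?_) (x := x) (by simp) (hDR x)
  · linarith
  · obtain ⟨z, hz, hyz⟩ := hDc.exists_infDist_eq_dist hD y
    have h1 := (abs_le.1 (hg.le y z)).1
    have h2 : g (dist y z) ≤ g (R * Real.exp (-(c * T))) :=
      hg.isModulus.strictMonoOn.monotoneOn dist_nonneg
        (show (0 : ℝ) ≤ R * Real.exp (-(c * T)) by positivity) (hyz ▸ hyd)
    have h3 : h ≤ u₀ z := not_lt.1 hz
    rw [hu.initial]
    linarith
  · have h1 : R' ≤ ‖y‖ := by
      by_contra! hlt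
      refine hy' (Metric.ball_subset_interior_closedBall ?_)
      rw [mem_ball_zero_iff]
      exact hlt.trans_le (le_max_left _ _)
    have := hR' y h1 t ht
    linarith
  · refine le_of_forall_gt fun r hr => ?_
    have hr' : -r / c < Metric.infDist y (sublevelD u₀ h)ᶜ :=
      (div_lt_iff₀' hc).2 (by linarith)
    obtain ⟨s, hs1, hs2⟩ := exists_between (max_lt hr' hy0)
    have hs0 : 0 < s := (le_max_right _ _).trans_lt hs1
    have hrs : -r < c * s := (div_lt_iff₀' hc).1 ((le_max_left _ _).trans_lt hs1)
    have hsR : s < R := by linarith [hDR y]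
    refine lt_of_le_of_lt ((hf.mono (by linarith) (mass_mono hΘ fun z hz => ?_)).trans
      (hdecay s ⟨hs0, hsR⟩)) (by linarith)
    have hz' : u z t ≤ u y t := hz
    -- Outside the ball `u` is at least `h`, but `u z t ≤ u y t < h - g (R * exp (-(c * T)))`.
    have hzB : z ∈ Metric.closedBall (0 : Space n) (max R' ‖x‖) := by
      rw [mem_closedBall_zero_iff]
      by_contra! hzn
      have := hR' z ((le_max_left _ _).trans hzn.le) t ⟨ht.1.le, ht.2.le⟩
      linarith
    refine mem_parallelD_of_lt_infDist hs0.le (hs2.trans_le ?_)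
    by_contra! hzd
    have := hlt z hzB hzd
    linarith

/-- The constant `L + 1` keeps the modulus strictly increasing even for `L = 0`. -/
theorem isModulusOfContinuity_of_holderWith {n : ℕ} {u₀ : Space n → ℝ} {L α : ℝ≥0}
    (hα : 0 < α) (hL : HolderWith L α u₀) :
    IsModulusOfContinuity u₀ fun r => (L + 1) * r ^ (α : ℝ) := by
  have hα' : (0 : ℝ) < α := hα
  have hL' : (0 : ℝ) < L + 1 := by positivity
  refine ⟨⟨?_, ?_, ?_⟩, fun x y => ?_⟩
  · exact (continuous_const.mul (Real.continuous_rpow_const hα'.le)).continuousOn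
  · exact fun r hr s _ hrs => mul_lt_mul_of_pos_left (Real.rpow_lt_rpow hr hrs hα') hL'
  · simp [Real.zero_rpow hα'.ne']
  · rw [← Real.dist_eq]
    refine (hL.dist_le x y).trans ?_
    gcongr
    linarith

end NonlocalHJ

/-! ### Choice of constants and conclusion -/

open NonlocalHJ in
theorem theorem1p3 (n : ℕ) (hn : 1 ≤ n)
    (f : ℝ → ℝ≥0 → ℝ) (Θ : NonlocalHJ.Space n → ℝ) (u₀ : NonlocalHJ.Space n → ℝ)
    (hf_reg : NonlocalHJ.RegularNonlinearity f)
    (hf_mono : NonlocalHJ.MonotoneNonlinearity f)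
    (hΘ : NonlocalHJ.PositiveDensity Θ)
    (hu₀ : NonlocalHJ.CoerciveInitialDatum u₀)
    (hbar : ℝ) (h_crit : NonlocalHJ.IsCriticalLevel f Θ u₀ hbar)
    (u : NonlocalHJ.Space n → ℝ → ℝ)
    (hu : NonlocalHJ.IsSolution f Θ u₀ u) (hu_growth : NonlocalHJ.LinearGrowth u)
    (h_below : NonlocalHJ.NondegenerateBelow f Θ u₀ hbar)
    (h_above : NonlocalHJ.UniformGrowthAbove f Θ u₀ hbar) :
    ∀ K : Set (NonlocalHJ.Space n), IsCompact K →
      ∃ C lam : ℝ, 0 < C ∧ 0 < lam ∧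
        (∀ g : ℝ → ℝ, NonlocalHJ.IsModulusOfContinuity u₀ g →
          ∃ T : ℝ, 0 ≤ T ∧ ∀ t : ℝ, T ≤ t → ∀ x ∈ K,
            |u x t - hbar| ≤ g (C * Real.exp (-(lam * t)))) ∧
        (∀ α : ℝ≥0, 0 < α → α ≤ 1 → (∃ L : ℝ≥0, HolderWith L α u₀) →
          ∃ C' : ℝ, 0 < C' ∧ ∃ T : ℝ, 0 ≤ T ∧ ∀ t : ℝ, T ≤ t → ∀ x ∈ K,
            |u x t - hbar| ≤ C' * Real.exp (-((α : ℝ) * lam * t))) := by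
  intro K hK
  have hcont : Continuous u₀ := hu₀.uniformContinuous.continuous
  have hE := h_crit.sublevelE_nonempty h_below hf_mono hΘ
  have hD := h_crit.compl_sublevelD_nonempty h_below
  obtain ⟨p, hp⟩ := hD
  obtain ⟨R₀, hR₀⟩ : ∃ R₀ : ℝ, ∀ y, R₀ ≤ ‖y‖ → hbar < u₀ y := by
    obtain ⟨c, hc, R₀, hR₀⟩ := hu₀.coercive p
    have hp' : hbar ≤ u₀ p := not_lt.1 fun hlt => hp hlt
    exact ⟨R₀, fun y hy => (hp'.trans_lt hc).trans_le (hR₀ y hy)⟩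
  have hEball : sublevelE u₀ hbar ⊆ Metric.closedBall 0 R₀ := fun y hy => by
    rw [mem_closedBall_zero_iff]
    by_contra! hlt
    exact (hR₀ y hlt.le).not_ge hy
  have hEb : Bornology.IsBounded (sublevelE u₀ hbar) := Metric.isBounded_closedBall.subset hEball
  -- the lower bound
  set R₁ : ℝ := 2 * (|R₀| + ‖p‖) + 1 with hR₁
  have hR₁0 : 0 < R₁ := by positivity
  have hDR : ∀ y, Metric.infDist y (sublevelD u₀ hbar)ᶜ < R₁ / 2 := fun y => by
    by_cases hy : y ∈ sublevelD u₀ hbar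
    · have h1 : ‖y‖ ≤ R₀ := mem_closedBall_zero_iff.1 (hEball (sublevelD_subset_sublevelE _ _ hy))
      have h2 := Metric.infDist_le_dist_of_mem (x := y) hp
      have h3 := (dist_eq_norm y p).trans_le (norm_sub_le y p)
      linarith [le_abs_self R₀]
    · rw [Metric.infDist_zero_of_mem hy]
      positivity
  obtain ⟨c, hc, hdecay⟩ := h_below.exists_le_of_lt hf_mono hΘ hR₁0
  -- the upper bound
  obtain ⟨ρ, hρ⟩ := (hK.image (Metric.continuous_infDist_pt (sublevelE u₀ hbar))).bddAbove
  obtain ⟨b₀, hb₀, hb⟩ := h_above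
  -- The growth condition reaches distance `1 / b ≥ 2 * (|ρ| + 1)`, which puts `K` within half of
  -- it.
  set b : ℝ := min (b₀ / 2) (1 / (2 * (|ρ| + 1))) with hbdef
  have hbpos : 0 < b := by positivity
  obtain ⟨a, ha, hgrow⟩ := hb b hbpos ((min_le_left _ _).trans_lt (by linarith))
  have hKR : ∀ x ∈ K, Metric.infDist x (sublevelE u₀ hbar) < 1 / b / 2 := fun x hx => by
    have h1 : Metric.infDist x (sublevelE u₀ hbar) ≤ ρ := hρ ⟨x, hx, rfl⟩
    have h2 : 2 * (|ρ| + 1) ≤ 1 / b := by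
      rw [le_one_div (by positivity) hbpos]
      exact min_le_right _ _
    linarith [le_abs_self ρ]
  have hgrowth : ∀ s ∈ Icc 0 (1 / b), a * s ≤ f hbar (mass Θ (parallelE u₀ hbar s)) :=
    fun s hs => by
      have h1 := hgrow hbar ⟨le_rfl, by linarith⟩ s hs
      have h2 := h_crit.2
      linarith
  have hmain : ∀ g : ℝ → ℝ, IsModulusOfContinuity u₀ g → ∀ t : ℝ, 0 ≤ t → ∀ x ∈ K,
      |u x t - hbar| ≤ g (max R₁ (1 / b) * Real.exp (-(min a c * t))) := by
    intro g hg t ht x hx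
    have hmono := hg.isModulus.strictMonoOn.monotoneOn
    have h0 : (0 : ℝ) < max R₁ (1 / b) := lt_max_of_lt_left hR₁0
    have h1 := hu.le_add_modulus hf_mono hΘ hcont ha (one_div_pos.2 hbpos) hE hEb hgrowth hg ht
      (hKR x hx)
    have h2 := hu.sub_modulus_le hf_reg hf_mono hΘ hcont hc hR₁0 (fun y hy => (hR₀ y hy).le)
      ⟨p, hp⟩ hDR hdecay hg ht x
    have hle : ∀ R l : ℝ, 0 < R → R ≤ max R₁ (1 / b) → min a c ≤ l →
        g (R * Real.exp (-(l * t))) ≤ g (max R₁ (1 / b) * Real.exp (-(min a c * t))) :=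
      fun R l hR hR' hl => hmono (show (0 : ℝ) ≤ _ by positivity) (show (0 : ℝ) ≤ _ by positivity)
        (by gcongr)
    have h3 := hle (1 / b) a (by positivity) (le_max_right _ _) (min_le_left _ _)
    have h4 := hle R₁ c hR₁0 (le_max_left _ _) (min_le_right _ _)
    rw [abs_le]
    constructor <;> linarith
  refine ⟨max R₁ (1 / b), min a c, lt_max_of_lt_left hR₁0, lt_min ha hc,
    fun g hg => ⟨0, le_rfl, hmain g hg⟩, fun α hα _ ⟨L, hL⟩ =>
    ⟨(L + 1) * max R₁ (1 / b) ^ (α : ℝ), by positivity, 0, le_rfl, fun t ht x hx => ?_⟩⟩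
  refine (hmain _ (isModulusOfContinuity_of_holderWith hα hL) t ht x hx).trans_eq ?_
  rw [Real.mul_rpow (by positivity) (Real.exp_pos _).le, ← Real.exp_mul, ← mul_assoc]
  congr 2
  ring
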